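/- Let $d\in\{2,3\}$, let $\Omega\subset\mathbb R^d$ be a bounded domain with smooth boundary $\Gamma$, and let $\Omega_0\subset\Omega$ be open. Let $P$ be one of the real Hilbert spaces $L^2(\Omega_0)$ or $H^1(\Omega_0)$. Let the real functions $g_1,g_2\in L^2(\Gamma)$ (for instance $g_1\in H^{1/2}(\Gamma)\cap L^\infty(\Gamma)$, $g_2\in L^\infty(\Gamma)$) be exact data, i.e. there are $p^\dagger\in P$ and $u^\dagger\in H^1(\Omega)$ such that, weakly, $-\Delta u^\dagger+u^\dagger=p^\dagger\chi_{\Omega_0}$ in $\Omega$ and $u^\dagger=g_1$, $\partial u^\dagger/\partial\mathbf n=g_2$ on $\Gamma$. For $p\in P$ let $u(p)\in H^1(\Omega;\mathbb C)$ be the weak solution of $$-\Delta u+u=p\chi_{\Omega_0}\ \text{in }\Omega,\qquad \frac{\partial u}{\partial\mathbf n}+iu=g_2+ig_1\ \text{on }\Gamma,$$ put $V(p)=\frac12\|\operatorname{Im}u(p)\|_{L^2(\Omega)}^2$, and let $w(p)\in H^1(\Omega;\mathbb C)$ be the weak solution of $$-\Delta w+w=\operatorname{Im}u(p)\ \text{in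 }\Omega,\qquad \frac{\partial w}{\partial\mathbf n}+iw=0\ \text{on }\Gamma.$$ Let $\nabla V(p)\in P$ be the gradient of $V$ with respect to the inner product of $P$: $(\nabla V(p),q)_P=\int_{\Omega_0}\operatorname{Im}w(p)\,q\,dx$ for all $q\in P$; for $P=L^2(\Omega_0)$ this means $\nabla V(p)=\operatorname{Im}w(p)|_{\Omega_0}$. Let $r\ge 3$, $p_0,\dot p_0\in P$, and let $p\in C^1([1,\infty),P)\cap C^2((1,\infty),P)$ solve $$\ddot p(t)+\frac rt\,\dot p(t)+\nabla V(p(t))=0\quad(t>1),\qquad p(1)=p_0,\ \dot p(1)=\dot p_0 .$$ Then $\dot p\in L^\infty([1,\infty),P)\cap L^2([1,\infty),P)$ and $\dot p(t)\to0$ in $P$ as $t\to\infty$. Moreover $V(p(t))=\mathcal O(t^{-2})$ as $t\to\infty$. -/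

import Mathlib

open MeasureTheory Filter Topology Set
open scoped ContDiff

namespace SOAR

/-- `ℝ^d` with the Euclidean norm. -/
abbrev Space (d : ℕ) : Type := EuclideanSpace ℝ (Fin d)

/-- A bounded domain (open and connected) with a smooth boundary: near each boundary point it is
the sublevel set `{ρ < 0}` of a smooth function with non-vanishing derivative. -/
structure IsSmoothBoundedDomain {d : ℕ} (Ω : Set (Space d)) : Prop where
  isOpen : IsOpen Ω
  isConnected : IsConnected Ω
  isBounded : Bornology.IsBounded Ω
  smooth_boundary : ∀ x ∈ frontier Ω, ∃ (U : Set (Space d)) (ρ : Space d → ℝ),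
    IsOpen U ∧ x ∈ U ∧ ContDiffOn ℝ ∞ ρ U ∧ (∀ y ∈ U, fderiv ℝ ρ y ≠ 0) ∧
      Ω ∩ U = {y ∈ U | ρ y < 0}

/-- The surface measure on `Γ = ∂Ω`: the `(d-1)`-dimensional Hausdorff measure in its Euclidean
normalization. -/
noncomputable def surface {d : ℕ} (Ω : Set (Space d)) : Measure (Space d) :=
  (Measure.euclideanHausdorffMeasure (d - 1)).restrict (frontier Ω)

/-- `L²(G)` with values in `𝕜`. -/
abbrev L2 (𝕜 : Type) [RCLike 𝕜] {d : ℕ} (G : Set (Space d)) : Type :=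
  Lp 𝕜 2 (volume.restrict G)

/-- `L²(G)` vector fields with values in `𝕜^d`. -/
abbrev L2Vec (𝕜 : Type) [RCLike 𝕜] {d : ℕ} (G : Set (Space d)) : Type :=
  Lp (EuclideanSpace 𝕜 (Fin d)) 2 (volume.restrict G)

/-- `L²(Γ; ℂ)`, where `Γ = ∂Ω`. -/
abbrev L2Boundary {d : ℕ} (Ω : Set (Space d)) : Type := Lp ℂ 2 (surface Ω)

/-- The partial derivative in the `i`-th coordinate direction. -/
noncomputable def pderiv {𝕜 : Type} [RCLike 𝕜] {d : ℕ} (i : Fin d) (φ : Space d → 𝕜)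
    (x : Space d) : 𝕜 :=
  fderiv ℝ φ x (EuclideanSpace.single i 1)

/-- The classical gradient `(∂₁φ, …, ∂_dφ)`. -/
noncomputable def grad {𝕜 : Type} [RCLike 𝕜] {d : ℕ} (φ : Space d → 𝕜) (x : Space d) :
    EuclideanSpace 𝕜 (Fin d) :=
  WithLp.toLp 2 (fun i => pderiv i φ x)

/-- `v` is the weak gradient of `u` on `G`: integration by parts holds against all smooth
functions with compact support in `G`. -/
def HasWeakGrad {𝕜 : Type} [RCLike 𝕜] {d : ℕ} {G : Set (Space d)} (u : L2 𝕜 G)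
    (v : L2Vec 𝕜 G) : Prop :=
  ∀ φ : Space d → ℝ, ContDiff ℝ ∞ φ → HasCompactSupport φ → tsupport φ ⊆ G →
    ∀ i : Fin d, ∫ x in G, pderiv i φ x • u x = -∫ x in G, φ x • v x i

theorem memLp_of_test {d : ℕ} {f : Space d → ℝ} (hf : Continuous f) (hc : HasCompactSupport f)
    (G : Set (Space d)) : MemLp f 2 (volume.restrict G) :=
  (hf.memLp_of_hasCompactSupport hc).restrict G

theorem pderiv_test {d : ℕ} {φ : Space d → ℝ} (hφ : ContDiff ℝ ∞ φ) (hc : HasCompactSupport φ)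
    (i : Fin d) (G : Set (Space d)) : MemLp (pderiv i φ) 2 (volume.restrict G) := by
  refine memLp_of_test ?_ ?_ G
  · exact (hφ.continuous_fderiv (by simp)).clm_apply continuous_const
  · exact hc.fderiv_apply (𝕜 := ℝ) (EuclideanSpace.single i 1)

theorem memLp_coord {𝕜 : Type} [RCLike 𝕜] {d : ℕ} {G : Set (Space d)} (v : L2Vec 𝕜 G)
    (i : Fin d) : MemLp (fun x => v x i) 2 (volume.restrict G) :=
  (EuclideanSpace.proj (𝕜 := 𝕜) i).comp_memLp' (Lp.memLp v)

theorem integrable_test_smul {𝕜 : Type} [RCLike 𝕜] {d : ℕ} {G : Set (Space d)}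
    {f : Space d → ℝ} {g : Space d → 𝕜} (hf : MemLp f 2 (volume.restrict G))
    (hg : MemLp g 2 (volume.restrict G)) :
    Integrable (fun x => f x • g x) (volume.restrict G) :=
  memLp_one_iff_integrable.1 (hg.smul hf)

/-- The Sobolev space `H¹(G)` of `𝕜`-valued functions: pairs `(u, ∇u)` of an `L²` function and its
`L²` weak gradient, with the inner product `∫ ∇u·∇v̄ + u v̄` (conjugate-linear in the
first argument of `inner`) inherited from `L²(G) × L²(G)^d`. -/
noncomputable def H1 (𝕜 : Type) [RCLike 𝕜] {d : ℕ} (G : Set (Space d)) :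
    Submodule 𝕜 (WithLp 2 (L2 𝕜 G × L2Vec 𝕜 G)) where
  carrier := {z | HasWeakGrad z.fst z.snd}
  zero_mem' := by
    intro φ _ _ _ i
    have h1 : ∫ x in G, pderiv i φ x • (0 : L2 𝕜 G) x = 0 := by
      rw [integral_eq_zero_of_ae]
      filter_upwards [Lp.coeFn_zero 𝕜 2 (volume.restrict G)] with x hx
      rw [hx]
      simp
    have h2 : ∫ x in G, φ x • (0 : L2Vec 𝕜 G) x i = 0 := by
      rw [integral_eq_zero_of_ae]
      filter_upwards [Lp.coeFn_zero (EuclideanSpace 𝕜 (Fin d)) 2 (volume.restrict G)] with x hx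
      rw [hx]
      simp
    change ∫ x in G, pderiv i φ x • (0 : L2 𝕜 G) x = -∫ x in G, φ x • (0 : L2Vec 𝕜 G) x i
    rw [h1, h2, neg_zero]
  add_mem' := by
    intro a b ha hb φ hφ hc hs i
    have h1 : ∫ x in G, pderiv i φ x • (a.fst + b.fst) x =
        (∫ x in G, pderiv i φ x • a.fst x) + ∫ x in G, pderiv i φ x • b.fst x := by
      rw [← integral_add (integrable_test_smul (pderiv_test hφ hc i G) (Lp.memLp a.fst))
        (integrable_test_smul (pderiv_test hφ hc i G) (Lp.memLp b.fst))]
      refine integral_congr_ae ?_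
      filter_upwards [Lp.coeFn_add a.fst b.fst] with x hx
      rw [hx]
      simp [smul_add]
    have h2 : ∫ x in G, φ x • (a.snd + b.snd) x i =
        (∫ x in G, φ x • a.snd x i) + ∫ x in G, φ x • b.snd x i := by
      rw [← integral_add (integrable_test_smul (memLp_of_test hφ.continuous hc G) (memLp_coord a.snd i))
        (integrable_test_smul (memLp_of_test hφ.continuous hc G) (memLp_coord b.snd i))]
      refine integral_congr_ae ?_
      filter_upwards [Lp.coeFn_add a.snd b.snd] with x hx
      rw [hx]
      simp [smul_add]
    have e1 := ha φ hφ hc hs i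
    have e2 := hb φ hφ hc hs i
    change ∫ x in G, pderiv i φ x • (a.fst + b.fst) x = -∫ x in G, φ x • (a.snd + b.snd) x i
    rw [h1, h2, e1, e2, neg_add]
  smul_mem' := by
    intro c a ha φ hφ hc hs i
    have h1 : ∫ x in G, pderiv i φ x • (c • a.fst) x = c * ∫ x in G, pderiv i φ x • a.fst x := by
      rw [← integral_const_mul]
      refine integral_congr_ae ?_
      filter_upwards [Lp.coeFn_smul c a.fst] with x hx
      simp [hx]
    have h2 : ∫ x in G, φ x • (c • a.snd) x i = c * ∫ x in G, φ x • a.snd x i := by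
      rw [← integral_const_mul]
      refine integral_congr_ae ?_
      filter_upwards [Lp.coeFn_smul c a.snd] with x hx
      simp [hx]
    change ∫ x in G, pderiv i φ x • (c • a.fst) x = -∫ x in G, φ x • (c • a.snd) x i
    rw [h1, h2, ha φ hφ hc hs i, mul_neg]

/-- The function underlying an element of `H¹(G)`. -/
noncomputable def toL2 {𝕜 : Type} [RCLike 𝕜] {d : ℕ} {G : Set (Space d)} (u : H1 𝕜 G) :
    L2 𝕜 G := u.1.fst

/-- The weak gradient of an element of `H¹(G)`. -/
noncomputable def weakGrad {𝕜 : Type} [RCLike 𝕜] {d : ℕ} {G : Set (Space d)} (u : H1 𝕜 G) :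
    L2Vec 𝕜 G := u.1.snd

/-- `τ ∈ L²(Γ)` is the trace of `u ∈ H¹(Ω)` (the continuous extension of the restriction to `Γ`):
some smooth functions converge to `u` in `H¹(Ω)` while their restrictions to `Γ` converge to `τ` in
`L²(Γ)`. -/
def IsTrace {d : ℕ} {Ω : Set (Space d)} (u : H1 ℂ Ω) (τ : L2Boundary Ω) : Prop :=
  ∃ φ : ℕ → Space d → ℂ, (∀ n, ContDiff ℝ ∞ (φ n)) ∧
    Tendsto (fun n => eLpNorm (fun x => φ n x - toL2 u x) 2 (volume.restrict Ω)) atTop (𝓝 0) ∧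
    Tendsto (fun n => eLpNorm (fun x => grad (φ n) x - weakGrad u x) 2 (volume.restrict Ω))
      atTop (𝓝 0) ∧
    Tendsto (fun n => eLpNorm (fun x => φ n x - τ x) 2 (surface Ω)) atTop (𝓝 0)

/-- `u` is the weak solution in `H¹(Ω; ℂ)` of `-Δu + u = F` in `Ω`, `∂u/∂n + i u = b` on `Γ`. Here
`inner ℂ ψ u = ∫_Ω ∇u·∇ψ̄ + u ψ̄` and `inner ℂ τψ τ = ∫_Γ u ψ̄`. -/
def IsRobinSolution {d : ℕ} {Ω : Set (Space d)} (F b : Space d → ℂ) (u : H1 ℂ Ω) : Prop :=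
  ∃ τ : L2Boundary Ω, IsTrace u τ ∧
    ∀ (ψ : H1 ℂ Ω) (τψ : L2Boundary Ω), IsTrace ψ τψ →
      inner ℂ ψ u + Complex.I * inner ℂ τψ τ =
        (∫ x in Ω, F x * star (toL2 ψ x)) + ∫ x, b x * star (τψ x) ∂(surface Ω)

/-- The right-hand side `p χ_{Ω₀}`. -/
noncomputable def source {d : ℕ} {Ω₀ : Set (Space d)} (p : L2 ℝ Ω₀) (x : Space d) : ℂ :=
  Ω₀.indicator (fun y => ((p y : ℝ) : ℂ)) x

/-- `u = u(p)`: the weak solution of `-Δu + u = p χ_{Ω₀}` in `Ω`, `∂u/∂n + i u = g₂ + i g₁` on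
`Γ`. -/
def IsState {d : ℕ} {Ω Ω₀ : Set (Space d)} (g₁ g₂ : Space d → ℝ) (p : L2 ℝ Ω₀) (u : H1 ℂ Ω) :
    Prop :=
  IsRobinSolution (source p) (fun x => (g₂ x : ℂ) + Complex.I * (g₁ x : ℂ)) u

/-- `w`: the weak solution of the adjoint problem `-Δw + w = u_im` in `Ω`, `∂w/∂n + i w = 0` on
`Γ`. -/
def IsAdjointState {d : ℕ} {Ω : Set (Space d)} (u w : H1 ℂ Ω) : Prop :=
  IsRobinSolution (fun x => ((toL2 u x).im : ℂ)) (fun _ => 0) w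

/-- `½ ‖u_im‖²_{L²(Ω)}`; this is `V(p)` when `u = u(p)`. -/
noncomputable def residual {d : ℕ} {Ω : Set (Space d)} (u : H1 ℂ Ω) : ℝ :=
  1 / 2 * ∫ x in Ω, (toL2 u x).im ^ 2

/-- `p` solves the inverse source problem: some `u ∈ H¹(Ω)` is a weak solution of
`-Δu + u = p χ_{Ω₀}` in `Ω` satisfying both `u = g₁` and `∂u/∂n = g₂` on `Γ`. -/
def IsExactSource {d : ℕ} (Ω : Set (Space d)) {Ω₀ : Set (Space d)} (g₁ g₂ : Space d → ℝ)
    (p : L2 ℝ Ω₀) : Prop :=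
  ∃ (u : H1 ℂ Ω) (τ : L2Boundary Ω), IsTrace u τ ∧ (∀ᵐ x ∂(surface Ω), τ x = (g₁ x : ℂ)) ∧
    ∀ (ψ : H1 ℂ Ω) (τψ : L2Boundary Ω), IsTrace ψ τψ →
      inner ℂ ψ u =
        (∫ x in Ω, source p x * star (toL2 ψ x)) + ∫ x, (g₂ x : ℂ) * star (τψ x) ∂(surface Ω)

/-- `G = w_im` on `Ω₀`, which is the gradient of `V` in `P = L²(Ω₀)`. -/
def IsGradL2 {d : ℕ} {Ω Ω₀ : Set (Space d)} (w : H1 ℂ Ω) (G : L2 ℝ Ω₀) : Prop :=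
  ∀ᵐ x ∂(volume.restrict Ω₀), G x = (toL2 w x).im

/-- `G` is the gradient of `V` in `P = H¹(Ω₀)`: it represents the derivative
`q ↦ ∫_{Ω₀} w_im q` of `V` in the inner product of `H¹(Ω₀)`. -/
def IsGradH1 {d : ℕ} {Ω Ω₀ : Set (Space d)} (w : H1 ℂ Ω) (G : H1 ℝ Ω₀) : Prop :=
  ∀ q : H1 ℝ Ω₀, inner ℝ G q = ∫ x in Ω₀, (toL2 w x).im * toL2 q x

/-- The flow `p̈ + (r/t) ṗ + ∇V(p) = 0` for `t > 1` in the source space `P` (with inclusion `ι` into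
`L²(Ω₀)`), with `p(1) = p₀`, `ṗ(1) = v₀`, coupled with the state `u(t)` and the adjoint state
`w(t)`. The functions `p'` and `p''` are the time derivatives `ṗ` and `p̈`. -/
structure IsNesterovFlow {d : ℕ} {Ω Ω₀ : Set (Space d)} {P : Type} [NormedAddCommGroup P]
    [InnerProductSpace ℝ P] (ι : P → L2 ℝ Ω₀) (isGrad : H1 ℂ Ω → P → Prop)
    (g₁ g₂ : Space d → ℝ) (r : ℝ) (p₀ v₀ : P) (p p' p'' : ℝ → P) (u w : ℝ → H1 ℂ Ω) : Prop where
  continuousOn : ContinuousOn p (Ici 1)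
  continuousOn' : ContinuousOn p' (Ici 1)
  init : p 1 = p₀
  init' : p' 1 = v₀
  hasDerivAt : ∀ t > 1, HasDerivAt p (p' t) t
  hasDerivAt' : ∀ t > 1, HasDerivAt p' (p'' t) t
  state : ∀ t > 1, IsState g₁ g₂ (ι (p t)) (u t)
  adjoint : ∀ t > 1, IsAdjointState (u t) (w t)
  equation : ∀ t > 1, ∃ G : P, isGrad (w t) G ∧ p'' t + (r / t) • p' t + G = 0

/-- `ṗ ∈ L^∞([1,∞),P) ∩ L²([1,∞),P)`, `ṗ(t) → 0` in `P`, and `V(p(t)) = O(t⁻²)`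
as `t → ∞`. -/
structure HasDecay {d : ℕ} {Ω : Set (Space d)} {P : Type} [NormedAddCommGroup P]
    (p' : ℝ → P) (u : ℝ → H1 ℂ Ω) : Prop where
  bounded : MemLp p' ⊤ (volume.restrict (Ici 1))
  squareIntegrable : MemLp p' 2 (volume.restrict (Ici 1))
  tendsto_zero : Tendsto p' atTop (𝓝 0)
  residual_rate : (fun t => residual (u t)) =O[atTop] fun t : ℝ => (t ^ 2)⁻¹

end SOAR

namespace SOAR

/-! ### Lyapunov analysis of the damped flow in an abstract inner product space. -/

section Flow

/-! Since `p ↦ Im u(p)` is affine and vanishes at the exact source (whose state is real), `V` is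
quadratic with minimum value 0. Testing the adjoint problem gives `(∇V(p), p - q) = (Im u(p), Im
u(p) - Im u(q))`. For `q = p†` this equals `2 V(p)`, twice what convexity alone would give as a
lower bound.

This extra factor lets one Lyapunov function, `t² (½‖ṗ‖² + V) + t² V + ½‖(r-1)(p - p†) + t ṗ‖²`, do
everything: along the flow its derivative is `-2(r-3) t V - (r-1) t ‖ṗ‖²`, nonpositive for `r ≥ 3`.
The growth `2tV` of the scaled energy is absorbed by the surplus in the second functional. Hence
`‖ṗ‖ = O(1/t)` and `V = O(1/t²)`, and the bound on `ṗ` contains all claims about it.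

The analytic half is `hasDecay_of_gradient_flow`; the PDE half is
`IsSourceResponse.integral_adjoint` (gradient identity), `IsSourceResponse.norm_le` (stability) and
`IsExactSource.exists_isState` (real exact state). -/

theorem memLp_Ici_of_norm_le_div {E : Type} [NormedAddCommGroup E] {f : ℝ → E} {C : ℝ}
    (hf : ContinuousOn f (Ici 1)) (hC : ∀ t ≥ 2, ‖f t‖ ≤ C / t) :
    MemLp f ⊤ (volume.restrict (Ici 1)) ∧ MemLp f 2 (volume.restrict (Ici 1)) ∧
      Tendsto f atTop (𝓝 0) := by
  have hC0 : 0 ≤ C := by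
    have := (norm_nonneg _).trans (hC 2 le_rfl)
    linarith
  obtain ⟨M, hM⟩ := isCompact_Icc.exists_bound_of_continuousOn
    (hf.mono (Icc_subset_Ici_self : Icc (1 : ℝ) 2 ⊆ Ici 1))
  have hM0 : 0 ≤ M := (norm_nonneg _).trans (hM 1 (by norm_num))
  have hmeas : AEStronglyMeasurable f (volume.restrict (Ici 1)) :=
    hf.aestronglyMeasurable measurableSet_Ici
  -- On `[1,2]` the bound `M` is at most `2M/t`, so one constant serves the whole half-line.
  have hbd : ∀ t ∈ Ici (1 : ℝ), ‖f t‖ ≤ (2 * M + C) / t := by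
    intro t ht
    have ht1 : (1 : ℝ) ≤ t := ht
    have ht0 : 0 < t := by linarith
    rcases le_total t 2 with h | h
    · refine (hM t ⟨ht1, h⟩).trans ?_
      rw [le_div_iff₀ ht0]
      nlinarith
    · refine (hC t h).trans ?_
      gcongr
      linarith
  refine ⟨?_, ?_, ?_⟩
  · refine memLp_top_of_bound hmeas (2 * M + C) ?_
    filter_upwards [ae_restrict_mem measurableSet_Ici] with t ht
    exact (hbd t ht).trans (div_le_self (by positivity) ht)
  · have hinv : MemLp (fun t : ℝ => (2 * M + C) / t) 2 (volume.restrict (Ici 1)) := by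
      rw [memLp_two_iff_integrable_sq (by fun_prop)]
      have h := (integrableOn_Ioi_rpow_of_lt (a := -2) (by norm_num) one_pos).const_mul
        ((2 * M + C) ^ 2)
      rw [Measure.restrict_congr_set Ioi_ae_eq_Ici] at h
      refine h.congr ?_
      filter_upwards [ae_restrict_mem measurableSet_Ici] with t ht
      have ht0 : (0 : ℝ) < t := lt_of_lt_of_le one_pos ht
      rw [Real.rpow_neg ht0.le]
      norm_num [div_eq_mul_inv, mul_pow]
    refine hinv.of_le hmeas ?_
    filter_upwards [ae_restrict_mem measurableSet_Ici] with t ht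
    exact (hbd t ht).trans (Real.le_norm_self _)
  · refine squeeze_zero_norm' ?_ (tendsto_const_nhds.div_atTop tendsto_id : Tendsto
      (fun t : ℝ => C / id t) atTop (𝓝 0))
    filter_upwards [eventually_ge_atTop 2] with t ht using hC t ht

variable {P : Type} [NormedAddCommGroup P] [InnerProductSpace ℝ P]

/-- The error is `O((s-t)²)` because `p` is differentiable at `t`. This gives a chain rule for `V`
along the path without differentiating the state in time. -/
theorem hasDerivAt_of_quadratic_error {p : ℝ → P} {v : P} {V : ℝ → ℝ} {t C : ℝ} {g : P}
    (hp : HasDerivAt p v t)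
    (h : ∀ᶠ s in 𝓝 t, |V s - V t - inner ℝ g (p s - p t)| ≤ C * ‖p s - p t‖ ^ 2) :
    HasDerivAt V (inner ℝ g v) t := by
  have h1 : HasDerivAt (fun s => inner ℝ g (p s)) (inner ℝ g v) t := by
    simpa using (hasDerivAt_const t g).inner ℝ hp
  have hO : (fun s => p s - p t) =O[𝓝 t] fun s => s - t := hp.isBigO_sub
  have hq : (fun s => V s - V t - inner ℝ g (p s - p t)) =O[𝓝 t] fun s => ‖p s - p t‖ ^ 2 :=
    Asymptotics.IsBigO.of_bound C (h.mono fun s hs => by simpa using hs)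
  have hq' : (fun s => V s - V t - inner ℝ g (p s - p t)) =o[𝓝 t] fun s => s - t := by
    refine hq.trans_isLittleO ((hO.norm_left.pow 2).trans_isLittleO ?_)
    have h0 : Tendsto (fun s : ℝ => s - t) (𝓝 t) (𝓝 0) :=
      (continuous_id.sub continuous_const).tendsto' t 0 (by simp)
    simpa [pow_two] using
      ((Asymptotics.isLittleO_one_iff ℝ).2 h0).mul_isBigO (Asymptotics.isBigO_refl _ _)
  have h2 := hasDerivAt_iff_isLittleO.1 h1
  rw [hasDerivAt_iff_isLittleO]
  refine (hq'.add h2).congr_left fun s => ?_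
  rw [inner_sub_right]
  ring

/-- The Lyapunov function of the damped gradient flow: the sum of the energy scaled by `t²` and of
the functional of Su, Boyd and Candès. -/
noncomputable def lyapunov (r : ℝ) (pd : P) (p p' : ℝ → P) (V : ℝ → ℝ) (t : ℝ) : ℝ :=
  t ^ 2 * (1 / 2 * ‖p' t‖ ^ 2 + V t) +
    (t ^ 2 * V t + 1 / 2 * ‖(r - 1) • (p t - pd) + t • p' t‖ ^ 2)

theorem hasDerivAt_lyapunov {r t : ℝ} {pd a G : P} {p p' : ℝ → P} {V : ℝ → ℝ}
    (ht : t ≠ 0) (hp : HasDerivAt p (p' t) t) (hp' : HasDerivAt p' a t)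
    (hV : HasDerivAt V (inner ℝ G (p' t)) t) (heq : a + (r / t) • p' t + G = 0)
    (hB : inner ℝ G (p t - pd) = 2 * V t) :
    HasDerivAt (lyapunov r pd p p' V)
      (-(2 * (r - 3) * t * V t) - (r - 1) * t * ‖p' t‖ ^ 2) t := by
  have hid := hasDerivAt_id t
  have hsq : HasDerivAt (fun s : ℝ => s ^ 2) (2 * t) t := by simpa using hasDerivAt_pow 2 t
  have h1 := hsq.mul ((hp'.norm_sq.const_mul (1 / 2 : ℝ)).add hV)
  have h2 := hsq.mul hV
  have h3 := (((hp.sub_const pd).const_smul (r - 1)).add (hid.smul hp')).norm_sq.const_mul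
    (1 / 2 : ℝ)
  refine (h1.add (h2.add h3)).congr_deriv ?_
  have ha : a = -((r / t) • p' t) - G := by
    rw [eq_sub_iff_add_eq, eq_neg_iff_add_eq_zero, ← heq]; abel
  -- The weight `r - 1` is chosen so that the damping term cancels, leaving only the gradient.
  have e1 : (r - 1) • p' t + (t • a + (1 : ℝ) • p' t) = -(t • G) := by
    have : t • ((r / t) • p' t) = r • p' t := by
      rw [smul_smul, mul_div_cancel₀ _ ht]
    rw [ha, smul_sub, smul_neg, this, sub_smul, one_smul]; abel
  have e2 : inner ℝ (p' t) a = -((r / t) * ‖p' t‖ ^ 2) - inner ℝ G (p' t) := by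
    rw [ha, inner_sub_right, inner_neg_right, inner_smul_right, real_inner_self_eq_norm_sq,
      real_inner_comm]
  have e3 : inner ℝ ((r - 1) • (p t - pd) + t • p' t) (t • G) =
      t * (2 * (r - 1) * V t + t * inner ℝ G (p' t)) := by
    rw [inner_smul_right, inner_add_left, inner_smul_left, inner_smul_left, real_inner_comm,
      hB, real_inner_comm]
    simp only [conj_trivial]; ring
  simp only [id, Pi.add_apply, Pi.smul_apply, Pi.smul_apply'] at *
  rw [e1, inner_neg_right, e3, e2]
  field_simp
  ring

theorem lyapunov_antitoneOn {r : ℝ} (hr : 3 ≤ r) {pd : P} {p p' p'' : ℝ → P} {V : ℝ → ℝ}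
    {G : ℝ → P} (hp : ∀ t > 1, HasDerivAt p (p' t) t) (hp' : ∀ t > 1, HasDerivAt p' (p'' t) t)
    (hV : ∀ t > 1, HasDerivAt V (inner ℝ (G t) (p' t)) t) (hV0 : ∀ t, 0 ≤ V t)
    (heq : ∀ t > 1, p'' t + (r / t) • p' t + G t = 0)
    (hB : ∀ t > 1, inner ℝ (G t) (p t - pd) = 2 * V t) :
    AntitoneOn (lyapunov r pd p p' V) (Ioi 1) := by
  have hd : ∀ t > 1, HasDerivAt (lyapunov r pd p p' V)
      (-(2 * (r - 3) * t * V t) - (r - 1) * t * ‖p' t‖ ^ 2) t := fun t ht =>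
    hasDerivAt_lyapunov (by linarith) (hp t ht) (hp' t ht) (hV t ht) (heq t ht) (hB t ht)
  refine antitoneOn_of_deriv_nonpos (convex_Ioi 1)
    (fun t ht => (hd t ht).continuousAt.continuousWithinAt) ?_ ?_
  · rw [interior_Ioi]
    exact fun t ht => (hd t ht).differentiableAt.differentiableWithinAt
  · rw [interior_Ioi]
    intro t ht
    have ht0 : 0 < t := lt_trans one_pos ht
    rw [(hd t ht).deriv]
    have h1 : 0 ≤ 2 * (r - 3) * t * V t :=
      mul_nonneg (mul_nonneg (by linarith) ht0.le) (hV0 t)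
    have h2 : 0 ≤ (r - 1) * t * ‖p' t‖ ^ 2 :=
      mul_nonneg (mul_nonneg (by linarith) ht0.le) (by positivity)
    linarith

theorem hasDecay_of_gradient_flow {d : ℕ} {Ω : Set (Space d)} {r C : ℝ} (hr : 3 ≤ r) {pd : P}
    {p p' p'' : ℝ → P} {u : ℝ → H1 ℂ Ω} {G : ℝ → P} (hcont : ContinuousOn p' (Ici 1))
    (hp : ∀ t > 1, HasDerivAt p (p' t) t) (hp' : ∀ t > 1, HasDerivAt p' (p'' t) t)
    (heq : ∀ t > 1, p'' t + (r / t) • p' t + G t = 0)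
    (hA : ∀ t > 1, ∀ s > 1, |residual (u s) - residual (u t) - inner ℝ (G t) (p s - p t)| ≤
      C * ‖p s - p t‖ ^ 2)
    (hB : ∀ t > 1, inner ℝ (G t) (p t - pd) = 2 * residual (u t)) :
    HasDecay p' u := by
  have hV0 : ∀ t, 0 ≤ residual (u t) := fun t =>
    mul_nonneg (by norm_num) (integral_nonneg fun x => sq_nonneg _)
  have hV : ∀ t > 1, HasDerivAt (fun s => residual (u s)) (inner ℝ (G t) (p' t)) t := fun t ht =>
    hasDerivAt_of_quadratic_error (hp t ht) ((eventually_gt_nhds ht).mono fun s hs => hA t ht s hs)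
  have hmono := lyapunov_antitoneOn (pd := pd) hr hp hp' hV hV0 heq hB
  -- The reference time must exceed 1, since nothing ties `u 1` to `p 1`; the remaining interval
  -- `[1,2]` is covered by continuity of `p'`.
  set K := lyapunov r pd p p' (fun s => residual (u s)) 2 with hK
  have hle : ∀ t ≥ 2, t ^ 2 * (1 / 2 * ‖p' t‖ ^ 2 + residual (u t)) ≤ K := by
    intro t ht
    have h := hmono (show (2 : ℝ) ∈ Ioi 1 by norm_num) (show t ∈ Ioi 1 by
      simp only [mem_Ioi]; linarith) ht
    refine le_trans (le_add_of_nonneg_right ?_) h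
    have := hV0 t
    positivity
  have hvel : ∀ t ≥ 2, ‖p' t‖ ≤ Real.sqrt (2 * K) / t := by
    intro t ht
    have ht0 : 0 < t := by linarith
    rw [le_div_iff₀ ht0]
    refine Real.le_sqrt_of_sq_le ?_
    have h1 := hle t ht
    have h2 : 0 ≤ t ^ 2 * residual (u t) := mul_nonneg (by positivity) (hV0 t)
    nlinarith
  obtain ⟨h1, h2, h3⟩ := memLp_Ici_of_norm_le_div hcont hvel
  refine ⟨h1, h2, h3, Asymptotics.IsBigO.of_bound K ?_⟩
  filter_upwards [eventually_ge_atTop 2] with t ht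
  have ht0 : 0 < t := by linarith
  rw [Real.norm_of_nonneg (hV0 t), Real.norm_of_nonneg (by positivity), ← div_eq_mul_inv,
    le_div_iff₀ (by positivity)]
  have h1 := hle t ht
  have h2 : 0 ≤ t ^ 2 * (1 / 2 * ‖p' t‖ ^ 2) := by positivity
  nlinarith

end Flow

variable {d : ℕ} {Ω Ω₀ : Set (Space d)}

/-! ### Traces of differences. -/

section Trace

theorem continuous_grad {φ : Space d → ℂ} (hφ : ContDiff ℝ ∞ φ) : Continuous (grad φ) := by
  refine (PiLp.continuous_toLp 2 _).comp (continuous_pi fun i => ?_)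
  exact (hφ.continuous_fderiv (by simp)).clm_apply continuous_const

theorem grad_sub {φ ψ : Space d → ℂ} (hφ : ContDiff ℝ ∞ φ) (hψ : ContDiff ℝ ∞ ψ) (x : Space d) :
    grad (fun y => φ y - ψ y) x = grad φ x - grad ψ x := by
  ext i
  have h1 := hφ.differentiable (by simp) x
  have h2 := hψ.differentiable (by simp) x
  simp [grad, pderiv, fderiv_fun_sub h1 h2]

theorem tendsto_eLpNorm_sub {α E : Type} [MeasurableSpace α] [NormedAddCommGroup E]
    {μ : Measure α} {f g : ℕ → α → E} {a b c : α → E}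
    (hf : ∀ n, AEStronglyMeasurable (fun x => f n x - a x) μ)
    (hg : ∀ n, AEStronglyMeasurable (fun x => g n x - b x) μ) (hc : c =ᵐ[μ] fun x => a x - b x)
    (h1 : Tendsto (fun n => eLpNorm (fun x => f n x - a x) 2 μ) atTop (𝓝 0))
    (h2 : Tendsto (fun n => eLpNorm (fun x => g n x - b x) 2 μ) atTop (𝓝 0)) :
    Tendsto (fun n => eLpNorm (fun x => f n x - g n x - c x) 2 μ) atTop (𝓝 0) := by
  refine tendsto_of_tendsto_of_tendsto_of_le_of_le tendsto_const_nhds (by simpa using h1.add h2)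
    (fun _ => zero_le) fun n => ?_
  refine le_trans (le_of_eq (eLpNorm_congr_ae ?_)) (eLpNorm_sub_le (hf n) (hg n) (by norm_num))
  filter_upwards [hc] with x hx
  simp only [hx, Pi.sub_apply]
  abel

theorem IsTrace.sub {u v : H1 ℂ Ω} {σ τ : L2Boundary Ω} (hu : IsTrace u σ) (hv : IsTrace v τ) :
    IsTrace (u - v) (σ - τ) := by
  obtain ⟨φ, hφ, a1, a2, a3⟩ := hu
  obtain ⟨ψ, hψ, b1, b2, b3⟩ := hv
  refine ⟨fun n x => φ n x - ψ n x, fun n => (hφ n).sub (hψ n), ?_, ?_, ?_⟩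
  · exact tendsto_eLpNorm_sub
      (fun n => (hφ n).continuous.aestronglyMeasurable.sub (Lp.aestronglyMeasurable _))
      (fun n => (hψ n).continuous.aestronglyMeasurable.sub (Lp.aestronglyMeasurable _))
      (Lp.coeFn_sub (toL2 u) (toL2 v)) a1 b1
  · simp only [grad_sub (hφ _) (hψ _)]
    exact tendsto_eLpNorm_sub
      (fun n => (continuous_grad (hφ n)).aestronglyMeasurable.sub (Lp.aestronglyMeasurable _))
      (fun n => (continuous_grad (hψ n)).aestronglyMeasurable.sub (Lp.aestronglyMeasurable _))
      (Lp.coeFn_sub (weakGrad u) (weakGrad v)) a2 b2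
  · exact tendsto_eLpNorm_sub
      (fun n => (hφ n).continuous.aestronglyMeasurable.sub (Lp.aestronglyMeasurable _))
      (fun n => (hψ n).continuous.aestronglyMeasurable.sub (Lp.aestronglyMeasurable _))
      (Lp.coeFn_sub σ τ) a3 b3

end Trace

/-! ### Complex conjugation on `H¹` and its traces. -/

section Conjugation

/-- Componentwise complex conjugation. -/
noncomputable def conjVec (v : EuclideanSpace ℂ (Fin d)) : EuclideanSpace ℂ (Fin d) :=
  WithLp.toLp 2 fun i => star (v i)

theorem norm_conjVec (v : EuclideanSpace ℂ (Fin d)) : ‖conjVec v‖ = ‖v‖ := by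
  simp [conjVec, EuclideanSpace.norm_eq]

theorem conjVec_sub (v w : EuclideanSpace ℂ (Fin d)) :
    conjVec v - conjVec w = conjVec (v - w) := by
  ext i
  simp [conjVec]

theorem lipschitzWith_conjVec :
    LipschitzWith 1 (conjVec : EuclideanSpace ℂ (Fin d) → EuclideanSpace ℂ (Fin d)) :=
  LipschitzWith.of_dist_le_mul fun v w => by
    rw [dist_eq_norm, conjVec_sub, norm_conjVec, dist_eq_norm]
    simp

theorem conjVec_zero : conjVec (0 : EuclideanSpace ℂ (Fin d)) = 0 := by
  ext i
  simp [conjVec]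

/-- Complex conjugation of vector fields. -/
noncomputable def conjL2Vec (v : L2Vec ℂ Ω) : L2Vec ℂ Ω :=
  lipschitzWith_conjVec.compLp conjVec_zero v

theorem coeFn_conjL2Vec (v : L2Vec ℂ Ω) :
    conjL2Vec v =ᵐ[volume.restrict Ω] fun x => conjVec (v x) :=
  lipschitzWith_conjVec.coeFn_compLp conjVec_zero v

theorem HasWeakGrad.conj {u : L2 ℂ Ω} {v : L2Vec ℂ Ω} (h : HasWeakGrad u v) :
    HasWeakGrad (star u) (conjL2Vec v) := by
  intro φ hφ hc hs i
  have e1 : ∫ x in Ω, pderiv i φ x • (star u : L2 ℂ Ω) x =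
      star (∫ x in Ω, pderiv i φ x • u x) := by
    rw [← starRingEnd_apply, ← integral_conj]
    refine integral_congr_ae ?_
    filter_upwards [Lp.coeFn_star u] with x hx
    simp [hx]
  have e2 : ∫ x in Ω, φ x • conjL2Vec v x i = star (∫ x in Ω, φ x • v x i) := by
    rw [← starRingEnd_apply, ← integral_conj]
    refine integral_congr_ae ?_
    filter_upwards [coeFn_conjL2Vec v] with x hx
    simp [hx, conjVec]
  rw [e1, e2, h φ hφ hc hs i, star_neg]

/-- Complex conjugation on `H¹(Ω; ℂ)`. -/
noncomputable def conjH1 (u : H1 ℂ Ω) : H1 ℂ Ω :=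
  ⟨WithLp.toLp 2 (star (toL2 u), conjL2Vec (weakGrad u)), u.2.conj⟩

theorem toL2_conjH1 (u : H1 ℂ Ω) : toL2 (conjH1 u) = star (toL2 u) := rfl

theorem weakGrad_conjH1 (u : H1 ℂ Ω) : weakGrad (conjH1 u) = conjL2Vec (weakGrad u) := rfl

theorem inner_H1 (u v : H1 ℂ Ω) :
    inner ℂ u v = inner ℂ (toL2 u) (toL2 v) + inner ℂ (weakGrad u) (weakGrad v) := rfl

/-- Conjugating the first slot turns the sesquilinear form into a bilinear one, whose symmetry
drives the duality argument. -/
theorem inner_star_left {α : Type} [MeasurableSpace α] {μ : Measure α} (f g : Lp ℂ 2 μ) :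
    inner ℂ (star f) g = ∫ x, f x * g x ∂μ := by
  rw [L2.inner_def]
  refine integral_congr_ae ?_
  filter_upwards [Lp.coeFn_star f] with x hx
  simp [hx, mul_comm]

theorem inner_star_comm {α : Type} [MeasurableSpace α] {μ : Measure α} (f g : Lp ℂ 2 μ) :
    inner ℂ (star f) g = inner ℂ (star g) f := by
  simp only [inner_star_left, mul_comm]

theorem inner_conjL2Vec_comm (v w : L2Vec ℂ Ω) :
    inner ℂ (conjL2Vec v) w = inner ℂ (conjL2Vec w) v := by
  rw [L2.inner_def, L2.inner_def]
  refine integral_congr_ae ?_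
  filter_upwards [coeFn_conjL2Vec v, coeFn_conjL2Vec w] with x hx hy
  simp [hx, hy, conjVec, PiLp.inner_apply, mul_comm]

theorem inner_conjH1_comm (u v : H1 ℂ Ω) : inner ℂ (conjH1 u) v = inner ℂ (conjH1 v) u := by
  rw [inner_H1, inner_H1, toL2_conjH1, toL2_conjH1, weakGrad_conjH1, weakGrad_conjH1,
    inner_star_comm, inner_conjL2Vec_comm]

theorem grad_star {φ : Space d → ℂ} (hφ : ContDiff ℝ ∞ φ) (x : Space d) :
    grad (fun y => star (φ y)) x = conjVec (grad φ x) := by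
  have h : HasFDerivAt (fun y => star (φ y))
      ((Complex.conjCLE : ℂ →L[ℝ] ℂ).comp (fderiv ℝ φ x)) x :=
    (Complex.conjCLE : ℂ →L[ℝ] ℂ).hasFDerivAt.comp x
      (hφ.differentiable (by simp) x).hasFDerivAt
  ext i
  simp only [grad, pderiv, conjVec, h.fderiv]
  rfl

theorem IsTrace.conj {u : H1 ℂ Ω} {τ : L2Boundary Ω} (h : IsTrace u τ) :
    IsTrace (conjH1 u) (star τ) := by
  obtain ⟨φ, hφ, h1, h2, h3⟩ := h
  refine ⟨fun n x => star (φ n x), fun n => ?_, h1.congr fun n => ?_, h2.congr fun n => ?_,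
    h3.congr fun n => ?_⟩
  · exact (Complex.conjCLE : ℂ →L[ℝ] ℂ).contDiff.comp (hφ n)
  · refine eLpNorm_congr_norm_ae ?_
    filter_upwards [Lp.coeFn_star (toL2 u)] with x hx
    rw [toL2_conjH1, hx, Pi.star_apply, ← star_sub, norm_star]
  · refine eLpNorm_congr_norm_ae ?_
    filter_upwards [coeFn_conjL2Vec (weakGrad u)] with x hx
    rw [weakGrad_conjH1, hx, grad_star (hφ n), conjVec_sub, norm_conjVec]
  · refine eLpNorm_congr_norm_ae ?_
    filter_upwards [Lp.coeFn_star τ] with x hx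
    rw [hx, Pi.star_apply, ← star_sub, norm_star]

end Conjugation

/-! ### The source term as an element of `L²(Ω; ℂ)`. -/

section Source

theorem memLp_source (hΩ₀ : IsOpen Ω₀) (q : L2 ℝ Ω₀) :
    MemLp (source q) 2 (volume.restrict Ω) := by
  refine MemLp.restrict Ω ?_
  exact (memLp_indicator_iff_restrict hΩ₀.measurableSet).2 (Lp.memLp q).ofReal

/-- The right-hand side `q χ_{Ω₀}` as an element of `L²(Ω; ℂ)`. -/
noncomputable def sourceL2 (Ω : Set (Space d)) (hΩ₀ : IsOpen Ω₀) (q : L2 ℝ Ω₀) : L2 ℂ Ω :=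
  (memLp_source hΩ₀ q).toLp

theorem coeFn_sourceL2 (hΩ₀ : IsOpen Ω₀) (q : L2 ℝ Ω₀) :
    sourceL2 Ω hΩ₀ q =ᵐ[volume.restrict Ω] source q :=
  (memLp_source hΩ₀ q).coeFn_toLp

theorem sourceL2_sub (hΩ₀ : IsOpen Ω₀) (q₁ q₂ : L2 ℝ Ω₀) :
    sourceL2 Ω hΩ₀ (q₁ - q₂) = sourceL2 Ω hΩ₀ q₁ - sourceL2 Ω hΩ₀ q₂ := by
  refine Lp.ext ?_
  have h := ae_restrict_of_ae (s := Ω)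
    ((ae_restrict_iff' hΩ₀.measurableSet).1 (Lp.coeFn_sub q₁ q₂))
  filter_upwards [h, coeFn_sourceL2 hΩ₀ (q₁ - q₂), Lp.coeFn_sub (sourceL2 Ω hΩ₀ q₁)
    (sourceL2 Ω hΩ₀ q₂), coeFn_sourceL2 hΩ₀ q₁, coeFn_sourceL2 hΩ₀ q₂] with x hx h1 h2 h3 h4
  rw [h1, h2, Pi.sub_apply, h3, h4]
  by_cases hm : x ∈ Ω₀
  · simp only [source, indicator_of_mem hm, hx hm, Pi.sub_apply, Complex.ofReal_sub]
  · simp [source, hm]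

theorem norm_sourceL2_le (hΩ₀ : IsOpen Ω₀) (q : L2 ℝ Ω₀) : ‖sourceL2 Ω hΩ₀ q‖ ≤ ‖q‖ := by
  rw [sourceL2, Lp.norm_toLp, Lp.norm_def]
  refine ENNReal.toReal_mono (Lp.eLpNorm_ne_top q) ?_
  refine (eLpNorm_mono_measure _ Measure.restrict_le_self).trans ?_
  unfold source
  rw [eLpNorm_indicator_eq_eLpNorm_restrict hΩ₀.measurableSet]
  exact (eLpNorm_congr_norm_ae (ae_of_all _ fun x => by simp)).le

theorem star_sourceL2 (hΩ₀ : IsOpen Ω₀) (q : L2 ℝ Ω₀) :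
    star (sourceL2 Ω hΩ₀ q) = sourceL2 Ω hΩ₀ q := by
  refine Lp.ext ?_
  filter_upwards [Lp.coeFn_star (sourceL2 Ω hΩ₀ q), coeFn_sourceL2 hΩ₀ q] with x h1 h2
  rw [h1, Pi.star_apply, h2]
  by_cases hm : x ∈ Ω₀
  · simp [source, hm]
  · simp [source, hm]

theorem integral_source_mul_star (hΩ₀ : IsOpen Ω₀) (q : L2 ℝ Ω₀) (f : L2 ℂ Ω) :
    ∫ x in Ω, source q x * star (f x) = inner ℂ f (sourceL2 Ω hΩ₀ q) := by
  rw [L2.inner_def]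
  refine integral_congr_ae ?_
  filter_upwards [coeFn_sourceL2 hΩ₀ q] with x hx
  simp [hx]

theorem im_inner_star_sourceL2 (hΩ₀ : IsOpen Ω₀) (hsub : Ω₀ ⊆ Ω) (q : L2 ℝ Ω₀) (f : L2 ℂ Ω) :
    (inner ℂ (star f) (sourceL2 Ω hΩ₀ q)).im = ∫ x in Ω₀, (f x).im * q x := by
  rw [inner_star_left]
  have h : ∫ x in Ω, f x * sourceL2 Ω hΩ₀ q x = ∫ x in Ω₀, f x * (q x : ℂ) := by
    rw [show ∫ x in Ω₀, f x * (q x : ℂ) = ∫ x in Ω ∩ Ω₀, f x * (q x : ℂ) by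
      rw [inter_eq_right.2 hsub], ← setIntegral_indicator hΩ₀.measurableSet]
    refine integral_congr_ae ?_
    filter_upwards [coeFn_sourceL2 hΩ₀ q] with x hx
    rw [hx]
    by_cases hm : x ∈ Ω₀
    · simp [source, hm]
    · simp [source, hm]
  have hf : MemLp f 2 (volume.restrict Ω₀) :=
    (Lp.memLp f).mono_measure (Measure.restrict_mono hsub le_rfl)
  have hint : Integrable (fun x => f x * (q x : ℂ)) (volume.restrict Ω₀) :=
    memLp_one_iff_integrable.1 ((Lp.memLp q).ofReal.mul hf)
  rw [h, ← RCLike.im_eq_complex_im, ← integral_im hint]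
  refine integral_congr_ae (ae_of_all _ fun x => ?_)
  simp

end Source

/-! ### Stability, adjoint identity and realness of the exact state. -/

section States

/-- The imaginary part of an `L²` function. -/
noncomputable def imL2 (f : L2 ℂ Ω) : L2 ℝ Ω := Complex.imCLM.compLp f

theorem coeFn_imL2 (f : L2 ℂ Ω) : imL2 f =ᵐ[volume.restrict Ω] fun x => (f x).im :=
  Complex.imCLM.coeFn_compLp' f

theorem imL2_sub (f g : L2 ℂ Ω) : imL2 (f - g) = imL2 f - imL2 g :=
  map_sub (Complex.imCLM.compLpₗ 2 (volume.restrict Ω)) f g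

theorem norm_imL2_le (f : L2 ℂ Ω) : ‖imL2 f‖ ≤ ‖f‖ := by
  refine Lp.norm_le_norm_of_ae_le ?_
  filter_upwards [coeFn_imL2 f] with x hx
  rw [hx]
  exact Complex.abs_im_le_norm _

theorem imL2_eq_zero {f : L2 ℂ Ω} (h : star f = f) : imL2 f = 0 := by
  refine Lp.ext ?_
  filter_upwards [coeFn_imL2 f, Lp.coeFn_star f, Lp.coeFn_zero ℝ 2 (volume.restrict Ω)]
    with x h1 h2 h3
  rw [h] at h2
  rw [h1, h3]
  exact Complex.conj_eq_iff_im.1 h2.symm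

theorem residual_eq (u : H1 ℂ Ω) : residual u = 1 / 2 * ‖imL2 (toL2 u)‖ ^ 2 := by
  rw [residual, ← real_inner_self_eq_norm_sq, L2.inner_def]
  congr 1
  refine integral_congr_ae ?_
  filter_upwards [coeFn_imL2 (toL2 u)] with x hx
  simp [hx, pow_two]

theorem im_integral_im_mul (f g : L2 ℂ Ω) :
    (∫ x in Ω, ((f x).im : ℂ) * g x).im = inner ℝ (imL2 f) (imL2 g) := by
  have hint : Integrable (fun x => ((f x).im : ℂ) * g x) (volume.restrict Ω) :=
    memLp_one_iff_integrable.1 ((Lp.memLp g).mul (Lp.memLp f).im.ofReal)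
  refine (integral_im hint).symm.trans ?_
  rw [L2.inner_def]
  refine integral_congr_ae ?_
  filter_upwards [coeFn_imL2 f, coeFn_imL2 g] with x h1 h2
  simp [h1, h2, mul_comm]

theorem norm_toL2_le {𝕜 : Type} [RCLike 𝕜] {G : Set (Space d)} (u : H1 𝕜 G) : ‖toL2 u‖ ≤ ‖u‖ :=
  WithLp.norm_fst_le (L2 𝕜 G) u.1

/-- The weak solution of the Robin problem with interior source `q χ_{Ω₀}` and no boundary
source. -/
def IsSourceResponse (Ω : Set (Space d)) (hΩ₀ : IsOpen Ω₀) (q : L2 ℝ Ω₀) (e : H1 ℂ Ω) : Prop :=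
  ∃ σ : L2Boundary Ω, IsTrace e σ ∧ ∀ (ψ : H1 ℂ Ω) (τψ : L2Boundary Ω), IsTrace ψ τψ →
    inner ℂ ψ e + Complex.I * inner ℂ τψ σ = inner ℂ (toL2 ψ) (sourceL2 Ω hΩ₀ q)

theorem IsState.sub {g₁ g₂ : Space d → ℝ} {q₁ q₂ : L2 ℝ Ω₀} {u₁ u₂ : H1 ℂ Ω} (hΩ₀ : IsOpen Ω₀)
    (h₁ : IsState g₁ g₂ q₁ u₁) (h₂ : IsState g₁ g₂ q₂ u₂) :
    IsSourceResponse Ω hΩ₀ (q₁ - q₂) (u₁ - u₂) := by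
  obtain ⟨τ₁, ht₁, e₁⟩ := h₁
  obtain ⟨τ₂, ht₂, e₂⟩ := h₂
  refine ⟨τ₁ - τ₂, ht₁.sub ht₂, fun ψ τψ hψ => ?_⟩
  have a₁ := e₁ ψ τψ hψ
  have a₂ := e₂ ψ τψ hψ
  rw [integral_source_mul_star hΩ₀] at a₁ a₂
  rw [sourceL2_sub, inner_sub_right, inner_sub_right, inner_sub_right]
  linear_combination a₁ - a₂

/-- Testing with `e` itself and taking real parts removes the boundary term `i‖σ‖²`; Cauchy–Schwarz
does the rest. -/
theorem IsSourceResponse.norm_le {hΩ₀ : IsOpen Ω₀} {q : L2 ℝ Ω₀} {e : H1 ℂ Ω}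
    (h : IsSourceResponse Ω hΩ₀ q e) : ‖e‖ ≤ ‖q‖ := by
  obtain ⟨σ, hσ, he⟩ := h
  have h1 := congrArg Complex.re (he e σ hσ)
  rw [inner_self_eq_norm_sq_to_K (𝕜 := ℂ) e, inner_self_eq_norm_sq_to_K] at h1
  have h2 : ‖e‖ ^ 2 = (inner ℂ (toL2 e) (sourceL2 Ω hΩ₀ q)).re := by
    rw [← h1]
    simp [← Complex.ofReal_pow]
  have h3 : ‖e‖ ^ 2 ≤ ‖e‖ * ‖q‖ := by
    rw [h2]
    refine (Complex.re_le_norm _).trans ((norm_inner_le_norm _ _).trans ?_)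
    exact mul_le_mul (norm_toL2_le e) (norm_sourceL2_le hΩ₀ q) (norm_nonneg _) (norm_nonneg _)
  rcases (norm_nonneg e).eq_or_lt with h0 | h0
  · rw [← h0]
    exact norm_nonneg q
  · nlinarith

theorem IsSourceResponse.integral_adjoint {hΩ₀ : IsOpen Ω₀} (hsub : Ω₀ ⊆ Ω) {q : L2 ℝ Ω₀}
    {e u w : H1 ℂ Ω} (h : IsSourceResponse Ω hΩ₀ q e) (hw : IsAdjointState u w) :
    ∫ x in Ω₀, (toL2 w x).im * q x = inner ℝ (imL2 (toL2 u)) (imL2 (toL2 e)) := by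
  obtain ⟨σ, hσ, he⟩ := h
  obtain ⟨τ, hτ, hw⟩ := hw
  -- With conjugated test functions both equations have the same left side, the symmetric form `∫_Ω
  -- (∇w·∇e + w e) + i ∫_Γ w e`; the identity is the imaginary part of the equality of right sides.
  have a1 := he (conjH1 w) (star τ) hτ.conj
  have a2 := hw (conjH1 e) (star σ) hσ.conj
  rw [inner_conjH1_comm, inner_star_comm, a2, toL2_conjH1, toL2_conjH1] at a1
  rw [← im_inner_star_sourceL2 hΩ₀ hsub, ← a1, ← im_integral_im_mul]
  congr 1
  simp only [zero_mul, integral_zero, add_zero]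
  refine integral_congr_ae ?_
  filter_upwards [Lp.coeFn_star (toL2 e)] with x hx
  simp [hx]

theorem IsExactSource.exists_isState {g₁ g₂ : Space d → ℝ} (hg₁ : MemLp g₁ 2 (surface Ω))
    (hg₂ : MemLp g₂ 2 (surface Ω)) (hΩ₀ : IsOpen Ω₀) {q : L2 ℝ Ω₀}
    (h : IsExactSource Ω g₁ g₂ q) : ∃ u : H1 ℂ Ω, IsState g₁ g₂ q u ∧ imL2 (toL2 u) = 0 := by
  obtain ⟨u, τ, hτ, hg, he⟩ := h
  refine ⟨u, ⟨τ, hτ, fun ψ τψ hψ => ?_⟩, imL2_eq_zero ?_⟩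
  -- Adding `i` times the Dirichlet condition to the Neumann condition yields the Robin condition.
  · have i₁ : Integrable (fun x => (g₁ x : ℂ) * star (τψ x)) (surface Ω) :=
      memLp_one_iff_integrable.1 ((Lp.memLp τψ).star.mul hg₁.ofReal)
    have i₂ : Integrable (fun x => (g₂ x : ℂ) * star (τψ x)) (surface Ω) :=
      memLp_one_iff_integrable.1 ((Lp.memLp τψ).star.mul hg₂.ofReal)
    have e1 : inner ℂ τψ τ = ∫ x, (g₁ x : ℂ) * star (τψ x) ∂(surface Ω) := by
      rw [L2.inner_def]
      refine integral_congr_ae ?_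
      filter_upwards [hg] with x hx
      simp [hx]
    have e2 : ∫ x, ((g₂ x : ℂ) + Complex.I * (g₁ x : ℂ)) * star (τψ x) ∂(surface Ω) =
        (∫ x, (g₂ x : ℂ) * star (τψ x) ∂(surface Ω)) +
          Complex.I * ∫ x, (g₁ x : ℂ) * star (τψ x) ∂(surface Ω) := by
      rw [← integral_const_mul, ← integral_add i₂ (i₁.const_mul _)]
      refine integral_congr_ae (ae_of_all _ fun x => ?_)
      ring
    rw [he ψ τψ hψ, e1, e2]
    ring
  -- The data are real, so the conjugate of `u` solves the same Neumann problem; testing with the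
  -- difference then forces `u` to be real.
  · have key : ∀ (ψ : H1 ℂ Ω) (τψ : L2Boundary Ω), IsTrace ψ τψ →
        inner ℂ ψ u = inner ℂ ψ (conjH1 u) := by
      intro ψ τψ hψ
      have a := congrArg star (he (conjH1 ψ) (star τψ) hψ.conj)
      have b := he ψ τψ hψ
      rw [integral_source_mul_star hΩ₀] at a b
      rw [star_add, toL2_conjH1] at a
      have c1 : star (inner ℂ (star (toL2 ψ)) (sourceL2 Ω hΩ₀ q)) =
          inner ℂ (toL2 ψ) (sourceL2 Ω hΩ₀ q) := by
        rw [inner_star_comm, star_sourceL2]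
        exact inner_conj_symm (𝕜 := ℂ) (toL2 ψ) (sourceL2 Ω hΩ₀ q)
      have c2 : star (∫ x, (g₂ x : ℂ) * star ((star τψ : L2Boundary Ω) x) ∂(surface Ω)) =
          ∫ x, (g₂ x : ℂ) * star (τψ x) ∂(surface Ω) := by
        rw [← starRingEnd_apply, ← integral_conj]
        refine integral_congr_ae ?_
        filter_upwards [Lp.coeFn_star τψ] with x hx
        simp [hx]
      have c3 : star (inner ℂ (conjH1 ψ) u) = inner ℂ ψ (conjH1 u) := by
        rw [inner_conjH1_comm]
        exact inner_conj_symm (𝕜 := ℂ) ψ (conjH1 u)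
      rw [c1, c2, ← b, c3] at a
      exact a.symm
    have hz : inner ℂ (u - conjH1 u) (u - conjH1 u) = 0 := by
      rw [inner_sub_right, key _ _ (hτ.sub hτ.conj), sub_self]
    have h0 : conjH1 u = u := (sub_eq_zero.1 ((inner_self_eq_zero (𝕜 := ℂ)).1 hz)).symm
    rw [← toL2_conjH1, h0]

end States

/-! ### Combination, for both source spaces at once. -/

section NesterovFlow

theorem IsNesterovFlow.hasDecay {P : Type} [NormedAddCommGroup P] [InnerProductSpace ℝ P]
    {ι : P → L2 ℝ Ω₀} {isGrad : H1 ℂ Ω → P → Prop} {g₁ g₂ : Space d → ℝ} {r : ℝ} {p₀ v₀ pd : P}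
    {p p' p'' : ℝ → P} {u w : ℝ → H1 ℂ Ω} (hΩ₀ : IsOpen Ω₀) (hsub : Ω₀ ⊆ Ω)
    (hι : ∀ a b, ι (a - b) = ι a - ι b) (hι' : ∀ a, ‖ι a‖ ≤ ‖a‖)
    (hgrad : ∀ w G, isGrad w G → ∀ q, inner ℝ G q = ∫ x in Ω₀, (toL2 w x).im * ι q x)
    (hg₁ : MemLp g₁ 2 (surface Ω)) (hg₂ : MemLp g₂ 2 (surface Ω)) (hr : 3 ≤ r)
    (hpd : IsExactSource Ω g₁ g₂ (ι pd))
    (h : IsNesterovFlow ι isGrad g₁ g₂ r p₀ v₀ p p' p'' u w) : HasDecay p' u := by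
  obtain ⟨ud, hud, him⟩ := hpd.exists_isState hg₁ hg₂ hΩ₀
  choose! G hG using h.equation
  -- This identity serves twice: `q = p s` gives the expansion of `V`, and `q = pd` gives the factor
  -- 2.
  have hinner : ∀ t > 1, ∀ (q : P) (v : H1 ℂ Ω), IsState g₁ g₂ (ι q) v →
      inner ℝ (G t) (p t - q) =
        inner ℝ (imL2 (toL2 (u t))) (imL2 (toL2 (u t)) - imL2 (toL2 v)) := by
    intro t ht q v hv
    rw [hgrad _ _ (hG t ht).1, hι,
      ((h.state t ht).sub hΩ₀ hv).integral_adjoint hsub (h.adjoint t ht), ← imL2_sub]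
    rfl
  refine hasDecay_of_gradient_flow (C := 1 / 2) (pd := pd) hr h.continuousOn' h.hasDerivAt
    h.hasDerivAt' (fun t ht => (hG t ht).2) ?_ ?_
  · intro t ht s hs
    have hle : ‖imL2 (toL2 (u s)) - imL2 (toL2 (u t))‖ ≤ ‖p s - p t‖ := by
      rw [← imL2_sub]
      refine (norm_imL2_le _).trans ((norm_toL2_le (u s - u t)).trans ?_)
      refine (((h.state s hs).sub hΩ₀ (h.state t ht)).norm_le).trans ?_
      rw [← hι]
      exact hι' _
    -- The second-order Taylor expansion of a quadratic is exact, hence the constant `1 / 2`.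
    have heq : residual (u s) - residual (u t) - inner ℝ (G t) (p s - p t) =
        1 / 2 * ‖imL2 (toL2 (u s)) - imL2 (toL2 (u t))‖ ^ 2 := by
      rw [← neg_sub (p t), inner_neg_right, hinner t ht _ _ (h.state s hs), residual_eq,
        residual_eq, norm_sub_sq_real, inner_sub_right, real_inner_self_eq_norm_sq,
        real_inner_comm]
      ring
    rw [heq, abs_of_nonneg (by positivity)]
    gcongr
  · intro t ht
    rw [hinner t ht _ _ hud, him, sub_zero, real_inner_self_eq_norm_sq, residual_eq]
    ring

end NesterovFlow

end SOAR

theorem lemma3p5 (d : ℕ) (hd : d = 2 ∨ d = 3) (Ω Ω₀ : Set (SOAR.Space d))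
    (hΩ : SOAR.IsSmoothBoundedDomain Ω) (hΩ₀ : IsOpen Ω₀) (hsub : Ω₀ ⊆ Ω)
    (g₁ g₂ : SOAR.Space d → ℝ) (hg₁ : MemLp g₁ 2 (SOAR.surface Ω))
    (hg₂ : MemLp g₂ 2 (SOAR.surface Ω)) (r : ℝ) (hr : 3 ≤ r) :
    -- the source space `P = L²(Ω₀)`
    (∀ pdag : SOAR.L2 ℝ Ω₀, SOAR.IsExactSource Ω g₁ g₂ pdag →
      ∀ (p₀ v₀ : SOAR.L2 ℝ Ω₀) (p p' p'' : ℝ → SOAR.L2 ℝ Ω₀) (u w : ℝ → SOAR.H1 ℂ Ω),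
        SOAR.IsNesterovFlow id SOAR.IsGradL2 g₁ g₂ r p₀ v₀ p p' p'' u w →
          SOAR.HasDecay p' u) ∧
    -- the source space `P = H¹(Ω₀)`
    (∀ pdag : SOAR.H1 ℝ Ω₀, SOAR.IsExactSource Ω g₁ g₂ (SOAR.toL2 pdag) →
      ∀ (p₀ v₀ : SOAR.H1 ℝ Ω₀) (p p' p'' : ℝ → SOAR.H1 ℝ Ω₀) (u w : ℝ → SOAR.H1 ℂ Ω),
        SOAR.IsNesterovFlow SOAR.toL2 SOAR.IsGradH1 g₁ g₂ r p₀ v₀ p p' p'' u w →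
          SOAR.HasDecay p' u) := by
  refine ⟨fun pdag hpd p₀ v₀ p p' p'' u w h => ?_, fun pdag hpd p₀ v₀ p p' p'' u w h => ?_⟩
  · refine h.hasDecay hΩ₀ hsub (fun _ _ => rfl) (fun _ => le_rfl) (fun w G hG q => ?_) hg₁ hg₂ hr hpd
    rw [L2.inner_def]
    refine integral_congr_ae ?_
    filter_upwards [hG] with x hx
    simp [hx, mul_comm]
  · exact h.hasDecay hΩ₀ hsub (fun _ _ => rfl) SOAR.norm_toL2_le (fun w G hG q => hG q) hg₁ hg₂ hr
      hpd
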